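/- Let $0<m\le L$, $\kappa=L/m$, and let $\mathcal S^2_{m,L}$ be the class of functions $f:\mathbb R^d\to\mathbb R$ ($d$ arbitrary) that are $m$-strongly convex, have an $L$-Lipschitz gradient, and are twice continuously differentiable. Let $\rho\in(0,1)$ satisfy $$\rho=\frac{\sqrt\kappa-1}{\sqrt\kappa+1}\ \text{ if }\kappa<9+4\sqrt5,\qquad \rho\in\Bigl(\rho_{\mathrm{C2M}},\,1-\sqrt{2/\kappa}\,\Bigr]\ \text{ if }\kappa\ge 9+4\sqrt5,$$ where $\rho_{\mathrm{C2M}}$ is the smallest positive root $\rho$ of $$\begin{aligned}p(\kappa,\rho)={}&8\kappa(\kappa+1)\rho^7-(23\kappa^2+18\kappa+7)\rho^6+2(5\kappa^2-14\kappa-7)\rho^5+(31\kappa^2+50\kappa+15)\rho^4\\&-4(11\kappa^2-4\kappa-11)\rho^3+(23\kappa^2-30\kappa+23)\rho^2-2(\kappa-1)(3\kappa+1)\rho+(\kappa-1)^2.\end{aligned}$$ (Since $\rho>0$, this forces $\kappa>1$.) The C2M method with these parameters is the iteration $$x_{k+1}=x_k+\beta(x_k-x_{k-1})-\alpha\nabla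 f\bigl(x_k+\eta(x_k-x_{k-1})\bigr),\qquad k\ge0,$$ with arbitrary initial conditions $x_{-1},x_0\in\mathbb R^d$ and $$\alpha=\frac{(1-\rho)^2}{m},\qquad \beta=\frac{\rho}{\kappa-1}\Bigl(1-\frac{\kappa(1-3\rho)}{1+\rho}\Bigr),\qquad \eta=\frac{\rho}{\kappa-1}\Bigl(\frac{1+\rho}{(1-\rho)^2}-\frac{\kappa}{1+\rho}\Bigr).$$ Then: 1. Every $f\in\mathcal S^2_{m,L}$ has a unique minimizer $x_\star$, and for all initial conditions $x_{-1},x_0\in\mathbb R^d$ the C2M iterates $x_k$ converge to $x_\star$. 2. The worst-case root-convergence factor of C2M over $\mathcal S^2_{m,L}$, i.e. the supremum of $\limsup_{k\to\infty}\|x_k-x_\star\|^{1/k}$ over all $f\in\mathcal S^2_{m,L}$ and all initial conditions, is at most $\rho$. -/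

import Mathlib

open Filter Topology
open scoped ENNReal Gradient

noncomputable section

/-- The class of `m`-strongly convex functions on `ℝᵈ` that have an `L`-Lipschitz gradient and are
twice continuously differentiable. -/
structure SmoothStronglyConvexC2 {d : ℕ} (m L : ℝ) (f : EuclideanSpace ℝ (Fin d) → ℝ) : Prop where
  contDiff : ContDiff ℝ 2 f
  strongConvex : StrongConvexOn Set.univ m f
  lipschitz_gradient : ∀ x y, ‖∇ f x - ∇ f y‖ ≤ L * ‖x - y‖

/-- One step of the momentum iteration: from `x = x_k` and `xprev = x_{k-1}` it computes `x_{k+1}`,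
the gradient being evaluated at `y_k = x_k + η (x_k - x_{k-1})`. -/
def momentumStep {d : ℕ} (α β η : ℝ) (f : EuclideanSpace ℝ (Fin d) → ℝ)
    (x xprev : EuclideanSpace ℝ (Fin d)) : EuclideanSpace ℝ (Fin d) :=
  x + β • (x - xprev) - α • ∇ f (x + η • (x - xprev))

/-- The iterates `x_0, x_1, x_2, …` of the momentum iteration with initial conditions
`xinit = x_{-1}` and `x0 = x_0`. -/
def momentumIterates {d : ℕ} (α β η : ℝ) (f : EuclideanSpace ℝ (Fin d) → ℝ)
    (xinit x0 : EuclideanSpace ℝ (Fin d)) : ℕ → EuclideanSpace ℝ (Fin d)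
  | 0 => x0
  | 1 => momentumStep α β η f x0 xinit
  | k + 2 => momentumStep α β η f (momentumIterates α β η f xinit x0 (k + 1))
      (momentumIterates α β η f xinit x0 k)

/-- The root-convergence factor `limsup ‖x_k - x⋆‖^{1/k}` of a sequence with limit `x⋆`, as an
extended nonnegative real, so that the limsup always exists. -/
def rootConvergenceFactor {E : Type*} [NormedAddCommGroup E] (x : ℕ → E) (xstar : E) : ℝ≥0∞ :=
  limsup (fun k : ℕ => ‖x k - xstar‖ₑ ^ (1 / (k : ℝ))) atTop

/-- The supremum of the root-convergence factors over all convergent sequences that the momentum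
iteration produces on a function of the class `F`. -/
def worstCaseRootConvergenceFactor {d : ℕ} (α β η : ℝ)
    (F : Set (EuclideanSpace ℝ (Fin d) → ℝ)) : ℝ≥0∞ :=
  sSup {r | ∃ f ∈ F, ∃ xinit x0 xstar : EuclideanSpace ℝ (Fin d),
    Tendsto (momentumIterates α β η f xinit x0) atTop (𝓝 xstar) ∧
      r = rootConvergenceFactor (momentumIterates α β η f xinit x0) xstar}

def c2mAlpha (m ρ : ℝ) : ℝ := (1 - ρ) ^ 2 / m

def c2mBeta (κ ρ : ℝ) : ℝ := ρ / (κ - 1) * (1 - κ * (1 - 3 * ρ) / (1 + ρ))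

def c2mEta (κ ρ : ℝ) : ℝ := ρ / (κ - 1) * ((1 + ρ) / (1 - ρ) ^ 2 - κ / (1 + ρ))

def c2mPoly (κ ρ : ℝ) : ℝ :=
  8 * κ * (κ + 1) * ρ ^ 7
    - (23 * κ ^ 2 + 18 * κ + 7) * ρ ^ 6
    + 2 * (5 * κ ^ 2 - 14 * κ - 7) * ρ ^ 5
    + (31 * κ ^ 2 + 50 * κ + 15) * ρ ^ 4
    - 4 * (11 * κ ^ 2 - 4 * κ - 11) * ρ ^ 3
    + (23 * κ ^ 2 - 30 * κ + 23) * ρ ^ 2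
    - 2 * (κ - 1) * (3 * κ + 1) * ρ
    + (κ - 1) ^ 2

/-- The smallest positive root of `c2mPoly κ`; see `isLeast_rhoC2M` for its existence. -/
def rhoC2M (κ : ℝ) : ℝ := sInf {r | 0 < r ∧ c2mPoly κ r = 0}

/-- The admissible choices of the parameter `ρ` for the condition number `κ`. -/
def IsC2MParameter (κ ρ : ℝ) : Prop :=
  (κ < 9 + 4 * √5 → ρ = (√κ - 1) / (√κ + 1)) ∧
    (9 + 4 * √5 ≤ κ → ρ ∈ Set.Ioc (rhoC2M κ) (1 - √(2 / κ)))

/-- `rhoC2M κ` is indeed the smallest positive root, and the interval of admissible parameters is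
nonempty. -/
theorem isLeast_rhoC2M {κ : ℝ} (hκ : 9 + 4 * √5 ≤ κ) :
    IsLeast {r | 0 < r ∧ c2mPoly κ r = 0} (rhoC2M κ) ∧ rhoC2M κ < 1 - √(2 / κ) := by
  have h5 : (2 : ℝ) < √5 := by
    rw [Real.lt_sqrt (by norm_num)]; norm_num
  have hκ17 : (17 : ℝ) < κ := by linarith
  have hκ0 : (0 : ℝ) < κ := by linarith
  obtain ⟨s, hs⟩ : ∃ s, s = √(2 / κ) := ⟨_, rfl⟩
  have hs0 : 0 < s := by rw [hs]; positivity
  have hs2 : s ^ 2 = 2 / κ := by rw [hs, Real.sq_sqrt (by positivity)]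
  have hκs : κ = 2 / s ^ 2 := by rw [hs2]; field_simp
  have hs3 : s < 7 / 20 := by
    have : s ^ 2 < (7 / 20) ^ 2 := by
      rw [hs2, div_lt_iff₀ hκ0]; linarith
    exact lt_of_pow_lt_pow_left₀ 2 (by norm_num) this
  have hval : c2mPoly κ (1 - s)
      = s ^ 2 * (-28 + 80 * s - 84 * s ^ 2 + 40 * s ^ 3 - 7 * s ^ 4) := by
    rw [hκs]; unfold c2mPoly; field_simp; ring
  have hneg : c2mPoly κ (1 - s) < 0 := by
    rw [hval]
    apply mul_neg_of_pos_of_neg (by positivity)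
    nlinarith [sq_nonneg (s - 7 / 20), pow_pos hs0 2, pow_pos hs0 3, pow_pos hs0 4,
      mul_pos (pow_pos hs0 2) (sub_pos.2 hs3)]
  have hpos : 0 < c2mPoly κ 0 := by
    have : c2mPoly κ 0 = (κ - 1) ^ 2 := by unfold c2mPoly; ring
    rw [this]; exact pow_pos (by linarith) 2
  have hcont : Continuous (c2mPoly κ) := by unfold c2mPoly; fun_prop
  obtain ⟨r, hr, hr0⟩ := intermediate_value_Icc' (by linarith : (0 : ℝ) ≤ 1 - s)
    hcont.continuousOn ⟨hneg.le, hpos.le⟩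
  have hrmem : r ∈ {r | 0 < r ∧ c2mPoly κ r = 0} := by
    refine ⟨lt_of_le_of_ne hr.1 ?_, hr0⟩
    rintro rfl
    exact hpos.ne' hr0
  have hrlt : r < 1 - s := by
    refine lt_of_le_of_ne hr.2 ?_
    rintro rfl
    exact hneg.ne hr0
  have hset : {r | 0 < r ∧ c2mPoly κ r = 0} = Set.Ici 0 ∩ c2mPoly κ ⁻¹' {0} := by
    ext t
    constructor
    · rintro ⟨h1, h2⟩
      exact ⟨h1.le, h2⟩
    · rintro ⟨h1, h2⟩
      refine ⟨lt_of_le_of_ne h1 ?_, h2⟩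
      rintro rfl
      exact hpos.ne' h2
  have hclosed : IsClosed {r | 0 < r ∧ c2mPoly κ r = 0} := by
    rw [hset]
    exact isClosed_Ici.inter (isClosed_singleton.preimage hcont)
  have hbdd : BddBelow {r | 0 < r ∧ c2mPoly κ r = 0} := ⟨0, fun t ht => ht.1.le⟩
  refine ⟨⟨hclosed.csInf_mem ⟨r, hrmem⟩ hbdd, fun t ht => csInf_le hbdd ht⟩, ?_⟩
  rw [← hs]
  exact (csInf_le hbdd hrmem).trans_lt hrlt

end

/-
At curvature `m` the C2M iteration has the double characteristic root `ρ`, and at curvature `L` the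
roots `-ρ` and `-c` with `0 < c ≤ ρ`. Global convergence comes from a Lyapunov function built from
the Zames–Falb inequality for the convex function `f - m/2 ‖· - x⋆‖²`: the frequency-domain
condition for its existence is a quadratic inequality in `cos θ`, whose discriminant is `p(κ, ρ)` up
to the factor `(1 + ρ)²`. A substitution that rationalizes the roots of `p` as a polynomial in `κ`
shows that `p` stays negative on the whole interval of admissible `ρ`. The rate is local
(Ostrowski): the linearization at the minimizer has spectral radius at most `ρ` for every Hessian
between `m` and `L`, which a quadratic Lyapunov function, affine in the Hessian, certifies with
every `σ > ρ`.
-/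

/-- Minus the second characteristic root of the C2M method at curvature `L`, the first one being
`-ρ`. -/
noncomputable def c2mRoot (κ ρ : ℝ) : ℝ := κ * (1 - ρ) ^ 2 / (1 + ρ) - 1

/-- The discriminant, in `cos θ`, of the frequency-domain inequality that certifies stability when
the characteristic polynomial is `(z - ρ)²` at curvature `m` and `(z + ρ) (z + c)` at curvature
`L`. -/
def c2mDisc (ρ c : ℝ) : ℝ :=
  (1 - 2 * ρ + 9 * ρ ^ 2 + 8 * ρ ^ 3) * c ^ 2 - 2 * ρ * (1 - ρ) * (1 + 7 * ρ + 4 * ρ ^ 2) * c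
    + ρ ^ 2 * (1 - ρ) ^ 2

theorem c2mPoly_eq_mul_c2mDisc {κ ρ : ℝ} (h : 1 + ρ ≠ 0) :
    c2mPoly κ ρ = (1 + ρ) ^ 2 * c2mDisc ρ (c2mRoot κ ρ) := by
  unfold c2mPoly c2mDisc c2mRoot
  field_simp
  ring

/-- Pole placement: at curvature `q` the momentum iteration has the characteristic polynomial
`z² - (1 + β - α q (1 + η)) z + (β - α q η)`, and this polynomial is `(z - ρ)²` for `q = m` and
`(z + ρ) (z + c)` for `q = L`. -/
structure HasEndpointRoots (m L α β η ρ c : ℝ) : Prop where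
  det_left : β - α * m * η = ρ ^ 2
  trace_left : 1 + β - α * m * (1 + η) = 2 * ρ
  det_right : β - α * L * η = ρ * c
  trace_right : 1 + β - α * L * (1 + η) = -(ρ + c)

theorem hasEndpointRoots_c2m {m L ρ : ℝ} (hm : m ≠ 0) (hκ : L / m ≠ 1) (h₀ : 1 + ρ ≠ 0)
    (h₁ : 1 - ρ ≠ 0) :
    HasEndpointRoots m L (c2mAlpha m ρ) (c2mBeta (L / m) ρ) (c2mEta (L / m) ρ) ρ
      (c2mRoot (L / m) ρ) := by
  have hκ' : L / m - 1 ≠ 0 := sub_ne_zero.2 hκ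
  have hαm : c2mAlpha m ρ * m = (1 - ρ) ^ 2 := div_mul_cancel₀ _ hm
  have hαL : c2mAlpha m ρ * L = L / m * (1 - ρ) ^ 2 := by
    unfold c2mAlpha
    ring
  have det_left : c2mBeta (L / m) ρ - (1 - ρ) ^ 2 * c2mEta (L / m) ρ = ρ ^ 2 := by
    unfold c2mBeta c2mEta
    generalize L / m = κ at hκ'
    field_simp
    ring
  have det_right : c2mBeta (L / m) ρ - L / m * (1 - ρ) ^ 2 * c2mEta (L / m) ρ
      = ρ * c2mRoot (L / m) ρ := by
    unfold c2mBeta c2mEta c2mRoot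
    generalize L / m = κ at hκ'
    field_simp
    ring
  have root : (1 + ρ) * c2mRoot (L / m) ρ = L / m * (1 - ρ) ^ 2 - (1 + ρ) := by
    rw [c2mRoot, mul_sub, mul_div_cancel₀ _ h₀, mul_one]
  constructor
  · rw [hαm, det_left]
  · linear_combination det_left - (1 + c2mEta (L / m) ρ) * hαm
  · rw [hαL, det_right]
  · linear_combination det_right + root - (1 + c2mEta (L / m) ρ) * hαL

/-- With `w = √((1 + ρ) / ρ)`, the largest value of `κ (1 - ρ) / (1 + ρ) - 1` at which the
discriminant `c2mDisc ρ (c2mRoot κ ρ)` vanishes. -/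
noncomputable def c2mThreshold (w : ℝ) : ℝ :=
  (w + 1) / (w ^ 3 - 3 * w ^ 2 + 2 * w + 2) + 1 / (w ^ 2 - 2)

/-- The amount by which `κ (1 - ρ) / (1 + ρ) - 1` exceeds its threshold; it has the sign of
`c2mPoly κ ρ`. -/
noncomputable def c2mGap (κ ρ : ℝ) : ℝ :=
  κ * ((1 - ρ) / (1 + ρ)) - 1 - c2mThreshold √((1 + ρ) / ρ)

theorem one_lt_c2mThreshold_den {w : ℝ} (hw₀ : 0 < w) (hw : 2 < w ^ 2) :
    1 < w ^ 3 - 3 * w ^ 2 + 2 * w + 2 := by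
  have h1 : 1 < w := by nlinarith
  nlinarith [mul_nonneg (sub_nonneg.2 h1.le) (sq_nonneg (w - 3 / 2)), sq_nonneg (w - 3 / 2)]

theorem c2mThreshold_key {v w : ℝ} (hv₀ : 0 < v) (hv : 2 < v ^ 2) (hw₀ : 0 < w) (hw : 2 < w ^ 2) :
    (v ^ 2 - 2) * (w ^ 2 - 2) * (3 - v * w)
      < (v ^ 3 - 3 * v ^ 2 + 2 * v + 2) * (w ^ 3 - 3 * w ^ 2 + 2 * w + 2) := by
  have hqq := one_lt_mul_of_lt_of_le (one_lt_c2mThreshold_den hv₀ hv)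
    (one_lt_c2mThreshold_den hw₀ hw).le
  have hvw : 0 < (v ^ 2 - 2) * (w ^ 2 - 2) := mul_pos (sub_pos.2 hv) (sub_pos.2 hw)
  have hle : (v ^ 2 - 2) * (w ^ 2 - 2) ≤ (v * w - 2) ^ 2 := by nlinarith [sq_nonneg (v - w)]
  rcases le_or_gt 3 (v * w) with h | h
  · nlinarith
  · have h2 : 2 < v * w := by nlinarith [mul_pos hv₀ hw₀]
    nlinarith

theorem strictAntiOn_c2mThreshold : StrictAntiOn c2mThreshold {w | 0 < w ∧ 2 < w ^ 2} := by
  rintro v ⟨hv₀, hv⟩ w ⟨hw₀, hw⟩ hvw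
  have hqv := one_lt_c2mThreshold_den hv₀ hv
  have hqw := one_lt_c2mThreshold_den hw₀ hw
  have key := c2mThreshold_key hv₀ hv hw₀ hw
  have hv2 : 0 < v ^ 2 - 2 := sub_pos.2 hv
  have hw2 : 0 < w ^ 2 - 2 := sub_pos.2 hw
  set qv := v ^ 3 - 3 * v ^ 2 + 2 * v + 2 with hqv'
  set qw := w ^ 3 - 3 * w ^ 2 + 2 * w + 2 with hqw'
  have diff : c2mThreshold v - c2mThreshold w
      = (w - v) * (((v + w) * (qv * qw - (v ^ 2 - 2) * (w ^ 2 - 2) * (3 - v * w))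
        + (v - w) ^ 2 * ((v ^ 2 - 2) * (w ^ 2 - 2)))
          / (qv * qw * ((v ^ 2 - 2) * (w ^ 2 - 2)))) := by
    unfold c2mThreshold
    rw [← hqv', ← hqw']
    have : qv ≠ 0 := by positivity
    have : qw ≠ 0 := by positivity
    field_simp
    rw [hqv', hqw']
    ring
  rw [← sub_pos, diff]
  have : 0 < qv * qw - (v ^ 2 - 2) * (w ^ 2 - 2) * (3 - v * w) := sub_pos.2 key
  have : 0 < w - v := sub_pos.2 hvw
  positivity

theorem strictAntiOn_c2mGap {κ : ℝ} (hκ : 0 < κ) : StrictAntiOn (c2mGap κ) (Set.Ioo 0 1) := by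
  rintro ρ ⟨hρ₀, hρ₁⟩ r ⟨hr₀, hr₁⟩ hρr
  have mem {t : ℝ} (ht₀ : 0 < t) (ht₁ : t < 1) :
      √((1 + t) / t) ∈ {w : ℝ | 0 < w ∧ 2 < w ^ 2} := by
    refine ⟨by positivity, ?_⟩
    rw [Real.sq_sqrt (by positivity), lt_div_iff₀ ht₀]
    linarith
  have hsqrt : √((1 + r) / r) < √((1 + ρ) / ρ) := by
    apply Real.sqrt_lt_sqrt (by positivity)
    rw [div_lt_div_iff₀ hr₀ hρ₀]
    linarith
  have hthreshold := strictAntiOn_c2mThreshold (mem hr₀ hr₁) (mem hρ₀ hρ₁) hsqrt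
  have hratio : (1 - r) / (1 + r) < (1 - ρ) / (1 + ρ) := by
    rw [div_lt_div_iff₀ (by linarith) (by linarith)]
    linarith
  have := mul_lt_mul_of_pos_left hratio hκ
  unfold c2mGap
  linarith

theorem c2mDisc_mul_eq_mul {ρ w : ℝ} (hρ : 0 < ρ) (hw : w ^ 2 = (1 + ρ) / ρ) (e : ℝ) :
    c2mDisc ρ ((1 - ρ) * e) = (1 - ρ) ^ 2 * ρ ^ 3 *
      ((w ^ 3 + 3 * w ^ 2 + 2 * w - 2) * e - (w - 1)) *
      ((w ^ 3 - 3 * w ^ 2 + 2 * w + 2) * e - (w + 1)) := by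
  have hw1 : w ^ 2 - 1 = 1 / ρ := by
    rw [hw]
    field_simp
    ring
  have hw1' : w ^ 2 - 1 ≠ 0 := by
    rw [hw1]
    positivity
  obtain rfl : ρ = 1 / (w ^ 2 - 1) := by rw [hw1, one_div_one_div]
  unfold c2mDisc
  field_simp
  ring

theorem c2mGap_eq {κ ρ : ℝ} (hρ : ρ ∈ Set.Ioo (0 : ℝ) 1) :
    c2mGap κ ρ = c2mRoot κ ρ / (1 - ρ) - (√((1 + ρ) / ρ) + 1) /
      (√((1 + ρ) / ρ) ^ 3 - 3 * √((1 + ρ) / ρ) ^ 2 + 2 * √((1 + ρ) / ρ) + 2) := by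
  obtain ⟨hρ₀, hρ₁⟩ := hρ
  have h₁ : 1 - ρ ≠ 0 := by linarith
  have hw : √((1 + ρ) / ρ) ^ 2 - 2 = (1 - ρ) / ρ := by
    rw [Real.sq_sqrt (by positivity)]
    field_simp
    ring
  have : κ * ((1 - ρ) / (1 + ρ)) - 1 - 1 / ((1 - ρ) / ρ) = c2mRoot κ ρ / (1 - ρ) := by
    unfold c2mRoot
    field_simp
    ring
  rw [c2mGap, c2mThreshold, hw, ← this]
  ring

theorem exists_pos_c2mPoly_eq_mul_c2mGap {κ ρ : ℝ} (hρ : ρ ∈ Set.Ioo (0 : ℝ) 1)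
    (h : 2 ≤ κ * (1 - ρ) ^ 2) : ∃ C, 0 < C ∧ c2mPoly κ ρ = C * c2mGap κ ρ := by
  have hgap := c2mGap_eq (κ := κ) hρ
  obtain ⟨hρ₀, hρ₁⟩ := hρ
  have hρ₁' : 0 < 1 - ρ := sub_pos.2 hρ₁
  have hw_sq : √((1 + ρ) / ρ) ^ 2 = (1 + ρ) / ρ := Real.sq_sqrt (by positivity)
  have hw₀ : 0 < √((1 + ρ) / ρ) := by positivity
  have hw2 : 2 < √((1 + ρ) / ρ) ^ 2 := by
    rw [hw_sq, lt_div_iff₀ hρ₀]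
    linarith
  set w := √((1 + ρ) / ρ)
  set e := c2mRoot κ ρ / (1 - ρ) with he
  have hden := one_lt_c2mThreshold_den hw₀ hw2
  have he2 : 1 / 2 < e := by
    rw [he, c2mRoot, lt_div_iff₀ hρ₁', lt_sub_iff_add_lt, lt_div_iff₀ (by linarith)]
    nlinarith
  have hleft : 0 < (w ^ 3 + 3 * w ^ 2 + 2 * w - 2) * e - (w - 1) := by
    have := pow_pos hw₀ 3
    nlinarith
  set q := w ^ 3 - 3 * w ^ 2 + 2 * w + 2
  refine ⟨(1 + ρ) ^ 2 * (1 - ρ) ^ 2 * ρ ^ 3 * ((w ^ 3 + 3 * w ^ 2 + 2 * w - 2) * e - (w - 1)) * q,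
    by positivity, ?_⟩
  have hroot : c2mRoot κ ρ = (1 - ρ) * e := (mul_div_cancel₀ _ hρ₁'.ne').symm
  have hright : q * e - (w + 1) = q * c2mGap κ ρ := by
    rw [hgap, mul_sub, mul_div_cancel₀ _ (by positivity)]
  rw [c2mPoly_eq_mul_c2mDisc (by positivity), hroot, c2mDisc_mul_eq_mul hρ₀ hw_sq, hright]
  ring

theorem two_le_mul_one_sub_sq {κ ρ : ℝ} (hκ : 0 < κ) (h : ρ ≤ 1 - √(2 / κ)) :
    2 ≤ κ * (1 - ρ) ^ 2 := by
  rw [mul_comm, ← div_le_iff₀ hκ]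
  exact Real.sqrt_le_iff.1 (le_sub_comm.1 h) |>.2

theorem c2mGap_neg {κ ρ : ℝ} (hκ : 9 + 4 * √5 ≤ κ) (hρ₁ : ρ < 1) (hρ : rhoC2M κ < ρ) :
    c2mGap κ ρ < 0 := by
  have hκ₀ : 0 < κ := lt_of_lt_of_le (by positivity) hκ
  obtain ⟨⟨⟨hr₀, hr⟩, -⟩, hr₁⟩ := isLeast_rhoC2M hκ
  have hr_mem : rhoC2M κ ∈ Set.Ioo (0 : ℝ) 1 := ⟨hr₀, hρ.trans hρ₁⟩
  obtain ⟨C, hC, hp⟩ :=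
    exists_pos_c2mPoly_eq_mul_c2mGap hr_mem (two_le_mul_one_sub_sq hκ₀ hr₁.le)
  have hgap : c2mGap κ (rhoC2M κ) = 0 := (mul_eq_zero.1 (hp.symm.trans hr)).resolve_left hC.ne'
  exact hgap ▸ strictAntiOn_c2mGap hκ₀ hr_mem ⟨hr₀.trans hρ, hρ₁⟩ hρ

/-- The rate of the optimally tuned heavy-ball method, which is the solution of
`c2mRoot κ ρ = ρ`. -/
noncomputable def heavyBallRate (κ : ℝ) : ℝ := (√κ - 1) / (√κ + 1)

theorem heavyBallRate_mem_Ioo {κ : ℝ} (hκ : 1 < κ) : heavyBallRate κ ∈ Set.Ioo (0 : ℝ) 1 := by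
  have hs : 1 < √κ := Real.lt_sqrt_of_sq_lt (by simpa using hκ)
  exact ⟨div_pos (by linarith) (by linarith), (div_lt_one (by linarith)).2 (by linarith)⟩

theorem mul_one_sub_heavyBallRate_sq {κ : ℝ} (hκ : 0 ≤ κ) :
    κ * (1 - heavyBallRate κ) ^ 2 = (1 + heavyBallRate κ) ^ 2 := by
  have : 0 ≤ √κ := Real.sqrt_nonneg κ
  nth_rw 1 [← Real.sq_sqrt hκ]
  unfold heavyBallRate
  field_simp
  ring

theorem c2mRoot_heavyBallRate {κ : ℝ} (hκ : 0 < κ) :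
    c2mRoot κ (heavyBallRate κ) = heavyBallRate κ := by
  have : 0 < √κ := Real.sqrt_pos.2 hκ
  have : 1 + heavyBallRate κ ≠ 0 := by
    have heq : 1 + heavyBallRate κ = 2 * √κ / (√κ + 1) := by
      unfold heavyBallRate
      field_simp
      ring
    rw [heq]
    positivity
  rw [c2mRoot, mul_one_sub_heavyBallRate_sq hκ.le]
  field_simp
  ring

theorem c2mDisc_self (ρ : ℝ) : c2mDisc ρ ρ = 16 * ρ ^ 3 * (ρ ^ 2 + ρ - 1) := by
  unfold c2mDisc
  ring

theorem heavyBallRate_sq_add_lt_one_iff {κ : ℝ} (hκ : 0 < κ) :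
    heavyBallRate κ ^ 2 + heavyBallRate κ < 1 ↔ κ < 9 + 4 * √5 := by
  have hs : 0 < √κ := Real.sqrt_pos.2 hκ
  have h5 : √5 ^ 2 = 5 := Real.sq_sqrt (by norm_num)
  have hle : 2 < √5 := Real.lt_sqrt_of_sq_lt (by norm_num)
  have factor : 1 - (heavyBallRate κ ^ 2 + heavyBallRate κ)
      = (2 + √5 - √κ) * ((√κ - 2 + √5) / (√κ + 1) ^ 2) := by
    unfold heavyBallRate
    field_simp
    linear_combination -h5
  have hpos : 0 < (√κ - 2 + √5) / (√κ + 1) ^ 2 := div_pos (by linarith) (by positivity)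
  have hsq : (2 + √5) ^ 2 = 9 + 4 * √5 := by linear_combination h5
  rw [← sub_pos, factor, mul_pos_iff_of_pos_right hpos, sub_pos, Real.sqrt_lt' (by positivity), hsq]

theorem c2mRoot_antitoneOn {κ : ℝ} (hκ : 0 ≤ κ) : AntitoneOn (c2mRoot κ) (Set.Icc 0 1) := by
  rintro r ⟨hr₀, -⟩ ρ ⟨-, hρ₁⟩ hrρ
  unfold c2mRoot
  have : 0 ≤ 1 - ρ := sub_nonneg.2 hρ₁
  gcongr

theorem heavyBallRate_le_of_c2mGap_neg {κ ρ : ℝ} (hκ : 9 + 4 * √5 ≤ κ)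
    (hρ : ρ ∈ Set.Ioo (0 : ℝ) 1) (hgap : c2mGap κ ρ < 0) : heavyBallRate κ ≤ ρ := by
  have hκ₁ : 1 < κ := lt_of_lt_of_le (by linarith [Real.sqrt_nonneg 5]) hκ
  have hκ₀ : 0 < κ := one_pos.trans hκ₁
  have hr := heavyBallRate_mem_Ioo hκ₁
  have hgolden : 1 ≤ heavyBallRate κ ^ 2 + heavyBallRate κ :=
    not_lt.1 fun h => hκ.not_gt ((heavyBallRate_sq_add_lt_one_iff hκ₀).1 h)
  obtain ⟨C, hC, hp⟩ := exists_pos_c2mPoly_eq_mul_c2mGap (κ := κ) hr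
    (by nlinarith [mul_one_sub_heavyBallRate_sq hκ₀.le, hr.1])
  have hp0 : 0 ≤ c2mPoly κ (heavyBallRate κ) := by
    rw [c2mPoly_eq_mul_c2mDisc (by linarith [hr.1]), c2mRoot_heavyBallRate hκ₀, c2mDisc_self]
    have := sub_nonneg.2 hgolden
    have := hr.1
    positivity
  by_contra! hlt
  have := strictAntiOn_c2mGap hκ₀ hρ hr hlt
  nlinarith

theorem one_lt_of_isC2MParameter {κ ρ : ℝ} (hρ : 0 < ρ) (h : IsC2MParameter κ ρ) : 1 < κ := by
  rcases lt_or_ge κ (9 + 4 * √5) with hk | hk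
  · rw [h.1 hk, div_pos_iff_of_pos_right (by positivity), sub_pos, Real.lt_sqrt zero_le_one] at hρ
    rwa [one_pow] at hρ
  · linarith [Real.sqrt_nonneg 5]

theorem c2mRoot_bounds {κ ρ : ℝ} (hκ : 1 < κ) (hρ : ρ ∈ Set.Ioo (0 : ℝ) 1)
    (h : IsC2MParameter κ ρ) :
    0 < c2mRoot κ ρ ∧ c2mRoot κ ρ ≤ ρ ∧ c2mDisc ρ (c2mRoot κ ρ) < 0 := by
  have hκ₀ : 0 < κ := one_pos.trans hκ
  have ⟨hρ₀, hρ₁⟩ := hρ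
  rcases lt_or_ge κ (9 + 4 * √5) with hk | hk
  · obtain rfl : ρ = heavyBallRate κ := h.1 hk
    rw [c2mRoot_heavyBallRate hκ₀, c2mDisc_self]
    refine ⟨hρ₀, le_rfl, mul_neg_of_pos_of_neg (by positivity) ?_⟩
    exact sub_neg.2 ((heavyBallRate_sq_add_lt_one_iff hκ₀).2 hk)
  · obtain ⟨hlow, hhigh⟩ := h.2 hk
    have h2 := two_le_mul_one_sub_sq hκ₀ hhigh
    have hgap := c2mGap_neg hk hρ₁ hlow
    refine ⟨?_, ?_, ?_⟩
    · rw [c2mRoot, sub_pos, lt_div_iff₀ (by linarith)]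
      linarith
    · have hr := heavyBallRate_mem_Ioo hκ
      have hrρ := heavyBallRate_le_of_c2mGap_neg hk hρ hgap
      calc c2mRoot κ ρ ≤ c2mRoot κ (heavyBallRate κ) :=
            c2mRoot_antitoneOn hκ₀.le ⟨hr.1.le, hr.2.le⟩ ⟨hρ₀.le, hρ₁.le⟩ hrρ
        _ = heavyBallRate κ := c2mRoot_heavyBallRate hκ₀
        _ ≤ ρ := hrρ
    · obtain ⟨C, hC, hp⟩ := exists_pos_c2mPoly_eq_mul_c2mGap hρ h2
      have hp_neg : c2mPoly κ ρ < 0 := hp ▸ mul_neg_of_pos_of_neg hC hgap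
      rw [c2mPoly_eq_mul_c2mDisc (by linarith)] at hp_neg
      exact (pos_iff_neg_of_mul_neg hp_neg).1 (by positivity)

section TangentBounds

variable {E : Type*} [NormedAddCommGroup E] [InnerProductSpace ℝ E]

/-- `G` is a selection of slopes of `f` for which `f` lies above its tangent paraboloids of
curvature `m` and below those of curvature `L`. -/
structure HasTangentBounds (m L : ℝ) (f : E → ℝ) (G : E → E) : Prop where
  lower : ∀ x y, f x + inner ℝ (G x) (y - x) + m / 2 * ‖y - x‖ ^ 2 ≤ f y
  upper : ∀ x y, f y ≤ f x + inner ℝ (G x) (y - x) + L / 2 * ‖y - x‖ ^ 2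

/-- The storage function `ℓ g - ‖∇g‖² / 2` of the Zames–Falb multiplier for the gradient `G` of a
convex function `g` of smoothness `ℓ`. -/
noncomputable def zamesFalbPotential (ℓ : ℝ) (g : E → ℝ) (G : E → E) (x : E) : ℝ :=
  ℓ * g x - ‖G x‖ ^ 2 / 2

namespace HasTangentBounds

variable {m L ℓ : ℝ} {f g : E → ℝ} {G : E → E}

theorem mul_norm_sq_le_inner (hf : HasTangentBounds m L f G) (x y : E) :
    m * ‖x - y‖ ^ 2 ≤ inner ℝ (G x - G y) (x - y) := by
  have hxy := hf.lower x y
  have hyx := hf.lower y x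
  rw [← neg_sub x y, inner_neg_right, norm_neg] at hxy
  rw [inner_sub_left]
  linarith

theorem inner_le_mul_norm_sq (hf : HasTangentBounds m L f G) (x y : E) :
    inner ℝ (G x - G y) (x - y) ≤ L * ‖x - y‖ ^ 2 := by
  have hxy := hf.upper x y
  have hyx := hf.upper y x
  rw [← neg_sub x y, inner_neg_right, norm_neg] at hxy
  rw [inner_sub_left]
  linarith

theorem mul_norm_le_norm (hf : HasTangentBounds m L f G) (x y : E) :
    m * ‖x - y‖ ≤ ‖G x - G y‖ := by
  rcases (norm_nonneg (x - y)).eq_or_lt with h | h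
  · simp [← h]
  · refine le_of_mul_le_mul_right ?_ h
    calc m * ‖x - y‖ * ‖x - y‖ = m * ‖x - y‖ ^ 2 := by ring
      _ ≤ inner ℝ (G x - G y) (x - y) := hf.mul_norm_sq_le_inner x y
      _ ≤ ‖G x - G y‖ * ‖x - y‖ := real_inner_le_norm _ _

theorem lt_of_ne (hf : HasTangentBounds m L f G) (hm : 0 < m) {x y : E} (hx : G x = 0)
    (hy : y ≠ x) : f x < f y := by
  have h := hf.lower x y
  rw [hx, inner_zero_left, add_zero] at h
  have : 0 < ‖y - x‖ := norm_pos_iff.2 (sub_ne_zero.2 hy)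
  exact lt_of_lt_of_le (lt_add_of_pos_right _ (by positivity)) h

theorem sub_quadratic (hf : HasTangentBounds m L f G) (q : ℝ) (a : E) :
    HasTangentBounds (m - q) (L - q) (fun x => f x - q / 2 * ‖x - a‖ ^ 2)
      (fun x => G x - q • (x - a)) := by
  have expand (x y : E) : q / 2 * ‖y - a‖ ^ 2 = q / 2 * ‖x - a‖ ^ 2
      + inner ℝ (q • (x - a)) (y - x) + q / 2 * ‖y - x‖ ^ 2 := by
    rw [← sub_add_sub_cancel' x a y, norm_add_sq_real, real_inner_smul_left]
    ring
  constructor <;> intro x y <;> rw [inner_sub_left]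
  · linarith [hf.lower x y, expand x y]
  · linarith [hf.upper x y, expand x y]

/- Both bounds are used at the point `p` reached from `y` by a gradient step for the function
`g - ⟪G z, ·⟫`, which is minimal at `z`. -/
theorem zamesFalbPotential_add_inner_le (hg : HasTangentBounds 0 ℓ g G) (hℓ : 0 < ℓ) (y z : E) :
    zamesFalbPotential ℓ g G z + inner ℝ (G z) ((ℓ • y - G y) - (ℓ • z - G z))
      ≤ zamesFalbPotential ℓ g G y := by
  obtain ⟨p, hp⟩ : ∃ p, p = y - ℓ⁻¹ • (G y - G z) := ⟨_, rfl⟩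
  have hpy : ℓ • (p - y) = -(G y - G z) := by
    rw [hp, sub_sub_cancel_left, smul_neg, smul_inv_smul₀ hℓ.ne']
  have hpz : ℓ • (p - z) = ℓ • y - ℓ • z - (G y - G z) := by
    rw [← sub_add_sub_cancel p y z, smul_add, hpy, smul_sub]
    abel
  have hlow := mul_le_mul_of_nonneg_left (hg.lower z p) hℓ.le
  have hup := mul_le_mul_of_nonneg_left (hg.upper y p) hℓ.le
  have hsq : ℓ * (ℓ / 2 * ‖p - y‖ ^ 2) = ‖G y - G z‖ ^ 2 / 2 := by
    rw [← norm_neg (G y - G z), ← hpy, norm_smul, Real.norm_of_nonneg hℓ.le]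
    ring
  have key : ℓ * g z + inner ℝ (G z) (ℓ • (p - z))
      ≤ ℓ * g y + inner ℝ (G y) (ℓ • (p - y)) + ‖G y - G z‖ ^ 2 / 2 := by
    simp only [inner_smul_right]
    linarith
  rw [hpz, hpy, norm_sub_sq_real] at key
  unfold zamesFalbPotential
  simp only [inner_sub_right, inner_neg_right, real_inner_self_eq_norm_sq,
    real_inner_comm (G y) (G z)] at key ⊢
  linarith

theorem zamesFalbPotential_le (hg : HasTangentBounds 0 ℓ g G) (hℓ : 0 < ℓ) {x : E} (hx : G x = 0)
    (y : E) : zamesFalbPotential ℓ g G x ≤ zamesFalbPotential ℓ g G y := by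
  simpa [hx] using hg.zamesFalbPotential_add_inner_le hℓ y x

end HasTangentBounds

theorem exists_eq_zero_of_strongly_monotone [CompleteSpace E] {m L : ℝ} {G : E → E} (hm : 0 < m)
    (hL : 0 < L) (hmono : ∀ x y, m * ‖x - y‖ ^ 2 ≤ inner ℝ (G x - G y) (x - y))
    (hlip : ∀ x y, ‖G x - G y‖ ≤ L * ‖x - y‖) : ∃ x, G x = 0 := by
  have ht : m / L ^ 2 ≠ 0 := by positivity
  have hcontr (x y : E) : ‖(x - (m / L ^ 2) • G x) - (y - (m / L ^ 2) • G y)‖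
      ≤ √(1 - m ^ 2 / L ^ 2) * ‖x - y‖ := by
    have hsub : (x - (m / L ^ 2) • G x) - (y - (m / L ^ 2) • G y)
        = (x - y) - (m / L ^ 2) • (G x - G y) := by module
    have hsq : ‖(x - y) - (m / L ^ 2) • (G x - G y)‖ ^ 2
        ≤ (1 - m ^ 2 / L ^ 2) * ‖x - y‖ ^ 2 := by
      rw [norm_sub_sq_real, real_inner_smul_right, real_inner_comm, norm_smul, mul_pow,
        Real.norm_of_nonneg (by positivity)]
      calc ‖x - y‖ ^ 2 - 2 * (m / L ^ 2 * inner ℝ (G x - G y) (x - y))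
            + (m / L ^ 2) ^ 2 * ‖G x - G y‖ ^ 2
          ≤ ‖x - y‖ ^ 2 - 2 * (m / L ^ 2 * (m * ‖x - y‖ ^ 2))
            + (m / L ^ 2) ^ 2 * (L * ‖x - y‖) ^ 2 := by
            gcongr
            · exact hmono x y
            · exact hlip x y
        _ = (1 - m ^ 2 / L ^ 2) * ‖x - y‖ ^ 2 := by
            field_simp
            ring
    rw [hsub, ← Real.sqrt_sq (norm_nonneg (x - y)), ← Real.sqrt_mul' _ (sq_nonneg _)]
    exact Real.le_sqrt_of_sq_le hsq
  have hcontracting : ContractingWith (√(1 - m ^ 2 / L ^ 2)).toNNReal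
      fun x => x - (m / L ^ 2) • G x := by
    refine ⟨?_, LipschitzWith.of_dist_le_mul fun x y => ?_⟩
    · rw [Real.toNNReal_lt_one, Real.sqrt_lt' one_pos, one_pow]
      exact sub_lt_self _ (by positivity)
    · rw [dist_eq_norm, dist_eq_norm, Real.coe_toNNReal _ (Real.sqrt_nonneg _)]
      exact hcontr x y
  have hfixed := hcontracting.fixedPoint_isFixedPt
  exact ⟨_, (smul_eq_zero.1 (sub_eq_self.1 hfixed)).resolve_left ht⟩

variable [CompleteSpace E] {m L : ℝ} {f : E → ℝ}

theorem hasDerivAt_comp_line {x v : E} {t : ℝ} (hf : DifferentiableAt ℝ f (x + t • v)) :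
    HasDerivAt (fun s : ℝ => f (x + s • v)) (inner ℝ (∇ f (x + t • v)) v) t := by
  have hline : HasDerivAt (fun s : ℝ => x + s • v) v t := by
    simpa using ((hasDerivAt_id t).smul_const v).const_add x
  have hcomp := hf.hasFDerivAt.comp_hasDerivAt t hline
  rwa [← inner_gradient_left] at hcomp

theorem add_inner_gradient_add_le_of_strongConvexOn {x : E} (hf : DifferentiableAt ℝ f x)
    (hconv : StrongConvexOn Set.univ m f) (y : E) :
    f x + inner ℝ (∇ f x) (y - x) + m / 2 * ‖y - x‖ ^ 2 ≤ f y := by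
  have hderiv := hasDerivAt_comp_line (x := x) (v := y - x) (t := 0) (by simpa using hf)
  rw [zero_smul, add_zero] at hderiv
  have hslope := (hasDerivAt_iff_tendsto_slope_zero.1 hderiv).mono_left
    (nhdsWithin_mono (s := Set.Ioi 0) (0 : ℝ) fun t ht => ht.ne')
  have hlim : Tendsto (fun t : ℝ => f y - f x - (1 - t) * (m / 2 * ‖y - x‖ ^ 2)) (𝓝[>] 0)
      (𝓝 (f y - f x - (1 - 0) * (m / 2 * ‖y - x‖ ^ 2))) :=
    tendsto_nhdsWithin_of_tendsto_nhds (Continuous.tendsto (by fun_prop) 0)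
  have hle := le_of_tendsto_of_tendsto hslope hlim (by
    filter_upwards [Ioc_mem_nhdsGT (zero_lt_one (α := ℝ))] with t ht
    have hc := hconv.2 (Set.mem_univ y) (Set.mem_univ x) ht.1.le (sub_nonneg.2 ht.2) (by ring)
    have hcomb : t • y + (1 - t) • x = x + t • (y - x) := by module
    rw [hcomb] at hc
    simp only [smul_eq_mul, zero_add, zero_smul, add_zero] at hc ⊢
    rw [inv_mul_le_iff₀ ht.1]
    linarith)
  linarith

theorem le_add_inner_gradient_add_of_lipschitz (hf : Differentiable ℝ f)
    (hlip : ∀ x y, ‖∇ f x - ∇ f y‖ ≤ L * ‖x - y‖) (x y : E) :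
    f y ≤ f x + inner ℝ (∇ f x) (y - x) + L / 2 * ‖y - x‖ ^ 2 := by
  obtain ⟨v, rfl⟩ : ∃ v, y = x + v := ⟨y - x, by abel⟩
  rw [add_sub_cancel_left]
  set φ : ℝ → ℝ := fun s => f (x + s • v) - s * inner ℝ (∇ f x) v - L / 2 * ‖v‖ ^ 2 * s ^ 2 with hφ
  have hderiv (t : ℝ) : HasDerivAt φ
      (inner ℝ (∇ f (x + t • v)) v - inner ℝ (∇ f x) v - L / 2 * ‖v‖ ^ 2 * (2 * t)) t := by
    have hlin := (hasDerivAt_id t).mul_const (inner ℝ (∇ f x) v)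
    have hsq := (hasDerivAt_pow 2 t).const_mul (L / 2 * ‖v‖ ^ 2)
    exact (((hasDerivAt_comp_line (hf _)).fun_sub hlin).fun_sub hsq).congr_deriv (by simp)
  have hanti : AntitoneOn φ (Set.Icc 0 1) := by
    refine antitoneOn_of_hasDerivWithinAt_nonpos (convex_Icc 0 1)
      (fun t _ => (hderiv t).continuousAt.continuousWithinAt)
      (fun t _ => (hderiv t).hasDerivWithinAt) fun t ht => ?_
    rw [interior_Icc] at ht
    have hgrad := hlip (x + t • v) x
    rw [add_sub_cancel_left, norm_smul, Real.norm_of_nonneg ht.1.le] at hgrad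
    rw [← inner_sub_left, sub_nonpos]
    calc inner ℝ (∇ f (x + t • v) - ∇ f x) v ≤ ‖∇ f (x + t • v) - ∇ f x‖ * ‖v‖ :=
          real_inner_le_norm _ _
      _ ≤ L * (t * ‖v‖) * ‖v‖ := by gcongr
      _ = L / 2 * ‖v‖ ^ 2 * (2 * t) := by ring
  have h := hanti (Set.left_mem_Icc.2 zero_le_one) (Set.right_mem_Icc.2 zero_le_one) zero_le_one
  simp only [hφ, one_smul, one_mul, one_pow, mul_one, zero_smul, add_zero, zero_mul, sub_zero,
    ne_eq, OfNat.ofNat_ne_zero, not_false_eq_true, zero_pow, mul_zero] at h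
  linarith

theorem hasTangentBounds_gradient (hf : Differentiable ℝ f)
    (hconv : StrongConvexOn Set.univ m f) (hlip : ∀ x y, ‖∇ f x - ∇ f y‖ ≤ L * ‖x - y‖) :
    HasTangentBounds m L f (∇ f) where
  lower x := add_inner_gradient_add_le_of_strongConvexOn (hf x) hconv
  upper := le_add_inner_gradient_add_of_lipschitz hf hlip

end TangentBounds

section GlobalConvergence

variable {E : Type*} [NormedAddCommGroup E] [InnerProductSpace ℝ E]

/-- The point at which the momentum iteration evaluates the gradient in order to produce
`x (k + 2)`. -/
def extrapolation (η : ℝ) (x : ℕ → E) (k : ℕ) : E := x (k + 1) + η • (x (k + 1) - x k)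

/-- `x` is a trajectory of the momentum iteration with an arbitrary map `G` as gradient. -/
def IsMomentumSequence (α β η : ℝ) (G : E → E) (x : ℕ → E) : Prop :=
  ∀ k, x (k + 2) = x (k + 1) + β • (x (k + 1) - x k) - α • G (extrapolation η x k)

/-- The supply rate `⟪X - 2ρY + ρ²Z, (X - Y) + (ρ + c)(Y - Z) + ρc(Z - W)⟫` of the Zames–Falb
multiplier along four successive errors, minus the dissipated quantities. -/
noncomputable def dissipationForm (ρ c h δ : ℝ) (X Y Z W : E) : ℝ :=
  inner ℝ (X - (2 * ρ) • Y + ρ ^ 2 • Z) ((X - Y) + (ρ + c) • (Y - Z) + (ρ * c) • (Z - W))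
    - ρ * c / 2 * ‖(X - Y) + (2 * h) • (Y - Z) + (Z - W)‖ ^ 2 - δ / 2 * ‖Y - Z‖ ^ 2

/-- The storage function of `dissipationForm`: the total of that form along the path
`0, 0, 0, Z, Y, X` starting at rest. -/
noncomputable def storageForm (ρ c h δ : ℝ) (X Y Z : E) : ℝ :=
  dissipationForm ρ c h δ X Y Z 0 + dissipationForm ρ c h δ Y Z 0 0
    + dissipationForm ρ c h δ Z 0 0 0

/-- The coefficients `h` and `δ` for which `dissipationForm` is the increment of `storageForm`.
They complete the square of the frequency-domain inequality in `cos θ`. -/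
structure IsDissipationPair (ρ c h δ : ℝ) : Prop where
  left : 4 * ρ * c * h = ρ * (1 - ρ) + c * (1 + ρ - 2 * ρ ^ 2)
  right : δ = 1 + 3 * ρ - 3 * ρ ^ 2 - ρ ^ 3 + c * (1 - 3 * ρ - 3 * ρ ^ 2 + ρ ^ 3)
    - 4 * ρ * c * h ^ 2

theorem tendsto_storageForm {ρ c h δ : ℝ} {u : ℕ → E} (hu : Tendsto u atTop (𝓝 0)) :
    Tendsto (fun n => storageForm ρ c h δ (u (n + 2)) (u (n + 1)) (u n)) atTop (𝓝 0) := by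
  have hcont : Continuous fun p : E × E × E => storageForm ρ c h δ p.1 p.2.1 p.2.2 := by
    unfold storageForm dissipationForm
    fun_prop
  have hu' : Tendsto (fun n => (u (n + 2), u (n + 1), u n)) atTop (𝓝 (0, 0, 0)) :=
    ((tendsto_add_atTop_iff_nat 2).2 hu).prodMk_nhds
      (((tendsto_add_atTop_iff_nat 1).2 hu).prodMk_nhds hu)
  have hlim := (hcont.tendsto (0, 0, 0)).comp hu'
  have hzero : storageForm ρ c h δ (0 : E) 0 0 = 0 := by simp [storageForm, dissipationForm]
  rwa [hzero] at hlim

theorem exists_isDissipationPair {ρ c : ℝ} (hρ : 0 < ρ) (hc : 0 < c) (hD : c2mDisc ρ c < 0) :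
    ∃ h δ, 0 < δ ∧ IsDissipationPair ρ c h δ := by
  refine ⟨(ρ * (1 - ρ) + c * (1 + ρ - 2 * ρ ^ 2)) / (4 * ρ * c), -c2mDisc ρ c / (4 * ρ * c),
    div_pos (neg_pos.2 hD) (by positivity), ?_, ?_⟩
  · field_simp
  · unfold c2mDisc
    field_simp
    ring

namespace IsDissipationPair

variable {ρ c h δ : ℝ}

theorem dissipationForm_eq_sub (H : IsDissipationPair ρ c h δ) (X Y Z W : E) :
    dissipationForm ρ c h δ X Y Z W = storageForm ρ c h δ X Y Z - storageForm ρ c h δ Y Z W := by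
  simp only [storageForm, dissipationForm, ← real_inner_self_eq_norm_sq, inner_add_left,
    inner_add_right, inner_sub_left, inner_sub_right, inner_smul_left, inner_smul_right,
    RCLike.conj_to_real, inner_zero_right, smul_zero, sub_zero, sub_self, add_zero, mul_zero,
    real_inner_comm X Y, real_inner_comm X Z, real_inner_comm X W, real_inner_comm Y Z,
    real_inner_comm Y W, real_inner_comm Z W]
  linear_combination
    (inner ℝ W W - 2 * inner ℝ Z W + inner ℝ Y W) * H.left + (inner ℝ Z W - inner ℝ W W) * H.right

theorem storageForm_le_of_eq_zero (H : IsDissipationPair ρ c h δ) (hρc : 0 ≤ ρ * c) (hδ : 0 ≤ δ)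
    {X Y Z : E} (hXYZ : X - (2 * ρ) • Y + ρ ^ 2 • Z = 0) (W : E) :
    storageForm ρ c h δ X Y Z ≤ storageForm ρ c h δ Y Z W := by
  have hform := H.dissipationForm_eq_sub X Y Z W
  rw [dissipationForm, hXYZ, inner_zero_left] at hform
  have : 0 ≤ ρ * c / 2 * ‖(X - Y) + (2 * h) • (Y - Z) + (Z - W)‖ ^ 2 := by positivity
  have : 0 ≤ δ / 2 * ‖Y - Z‖ ^ 2 := by positivity
  linarith

/- The input-free trajectory from `(X, Y)` tends to rest, and the storage function decreases
along it. -/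
theorem storageForm_nonneg (H : IsDissipationPair ρ c h δ) (hρ₀ : 0 < ρ) (hρ₁ : ρ < 1)
    (hc : 0 ≤ c) (hδ : 0 ≤ δ) (X Y Z : E) : 0 ≤ storageForm ρ c h δ X Y Z := by
  have hρc : 0 ≤ ρ * c := by positivity
  set u : ℕ → E := fun n => ρ ^ n • Y + (n * ρ ^ n) • (ρ⁻¹ • X - Y) with hu
  have hrec (n : ℕ) : u (n + 2) - (2 * ρ) • u (n + 1) + ρ ^ 2 • u n = 0 := by
    simp only [hu]
    push_cast
    module
  have hu₀ : u 0 = Y := by simp [hu]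
  have hu₁ : u 1 = X := by simp [hu, smul_sub, smul_inv_smul₀ hρ₀.ne']
  have hanti : Antitone fun n => storageForm ρ c h δ (u (n + 2)) (u (n + 1)) (u n) :=
    antitone_nat_of_succ_le fun n => H.storageForm_le_of_eq_zero hρc hδ (hrec (n + 1)) _
  have hu_lim : Tendsto u atTop (𝓝 0) := by
    have hpow := (tendsto_pow_atTop_nhds_zero_of_lt_one hρ₀.le hρ₁).smul_const Y
    have hmul := (tendsto_self_mul_const_pow_of_lt_one hρ₀.le hρ₁).smul_const (ρ⁻¹ • X - Y)
    simpa only [zero_smul, add_zero] using hpow.add hmul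
  calc 0 ≤ storageForm ρ c h δ (u 2) (u 1) (u 0) :=
        hanti.le_of_tendsto (tendsto_storageForm hu_lim) 0
    _ ≤ storageForm ρ c h δ (u 1) (u 0) Z := H.storageForm_le_of_eq_zero hρc hδ (hrec 0) Z
    _ = storageForm ρ c h δ X Y Z := by rw [hu₀, hu₁]

end IsDissipationPair

theorem tendsto_zero_of_le_sub_succ {a V : ℕ → ℝ} {B : ℝ} (ha : ∀ k, 0 ≤ a k)
    (hV : ∀ k, B ≤ V k) (h : ∀ k, a k ≤ V k - V (k + 1)) : Tendsto a atTop (𝓝 0) := by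
  have hanti : Antitone V := antitone_nat_of_succ_le fun k => sub_nonneg.1 ((ha k).trans (h k))
  have hlim := tendsto_atTop_ciInf hanti ⟨B, Set.forall_mem_range.2 hV⟩
  have hdiff : Tendsto (fun k => V k - V (k + 1)) atTop (𝓝 0) := by
    simpa using hlim.sub (hlim.comp (tendsto_add_atTop_nat 1))
  exact squeeze_zero ha h hdiff

/-- The Lyapunov function of the momentum iteration: the Zames–Falb potential `Φ` at the
extrapolated point plus the storage function of the last three errors. -/
noncomputable def momentumEnergy (Φ : E → ℝ) (α η ρ c h δ : ℝ) (a : E) (x : ℕ → E) (k : ℕ) : ℝ :=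
  α ^ 2 * Φ (extrapolation η x k)
    + storageForm ρ c h δ (x (k + 2) - a) (x (k + 1) - a) (x k - a)

namespace IsMomentumSequence

variable {m L α β η ρ c h δ : ℝ} {f : E → ℝ} {G : E → E} {x : ℕ → E} {a : E}

theorem smul_curvature_sub (hx : IsMomentumSequence α β η G x) (q : ℝ) (a : E) (k : ℕ) :
    α • (q • (extrapolation η x k - a) - G (extrapolation η x k))
      = (x (k + 2) - a) - (1 + β - α * q * (1 + η)) • (x (k + 1) - a)
        + (β - α * q * η) • (x k - a) := by
  rw [hx k, smul_sub]
  unfold extrapolation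
  module

theorem smul_gradient_sub (hx : IsMomentumSequence α β η G x)
    (hR : HasEndpointRoots m L α β η ρ c) (a : E) (k : ℕ) :
    α • (G (extrapolation η x k) - m • (extrapolation η x k - a))
      = -((x (k + 2) - a) - (2 * ρ) • (x (k + 1) - a) + ρ ^ 2 • (x k - a)) := by
  rw [← neg_sub, smul_neg, hx.smul_curvature_sub, hR.trace_left, hR.det_left]

theorem smul_output_sub (hx : IsMomentumSequence α β η G x)
    (hR : HasEndpointRoots m L α β η ρ c) (k : ℕ) :
    let v (j : ℕ) := L • extrapolation η x j - G (extrapolation η x j)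
    α • (v (k + 1) - v k) = (x (k + 3) - x (k + 2)) + (ρ + c) • (x (k + 2) - x (k + 1))
      + (ρ * c) • (x (k + 1) - x k) := by
  intro v
  have hv (j : ℕ) : α • v j = x (j + 2) + (ρ + c) • x (j + 1) + (ρ * c) • x j := by
    have := hx.smul_curvature_sub L 0 j
    simpa only [sub_zero, hR.trace_right, hR.det_right, neg_smul, sub_neg_eq_add] using this
  rw [smul_sub, hv, hv]
  module

theorem le_momentumEnergy_sub_succ (hx : IsMomentumSequence α β η G x)
    (hf : HasTangentBounds m L f G) (hmL : m < L) (hR : HasEndpointRoots m L α β η ρ c)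
    (H : IsDissipationPair ρ c h δ) (hρc : 0 ≤ ρ * c) (a : E) (k : ℕ) :
    let V := momentumEnergy (zamesFalbPotential (L - m) (fun y => f y - m / 2 * ‖y - a‖ ^ 2)
      (fun y => G y - m • (y - a))) α η ρ c h δ a x
    δ / 2 * ‖x (k + 2) - x (k + 1)‖ ^ 2 ≤ V k - V (k + 1) := by
  have hg := hf.sub_quadratic m a
  rw [sub_self] at hg
  have supply := mul_le_mul_of_nonneg_left (hg.zamesFalbPotential_add_inner_le (sub_pos.2 hmL)
    (extrapolation η x k) (extrapolation η x (k + 1))) (sq_nonneg α)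
  set y := extrapolation η x with hy
  have output : (((L - m) • y k - (G (y k) - m • (y k - a)))
      - ((L - m) • y (k + 1) - (G (y (k + 1)) - m • (y (k + 1) - a))))
      = -((L • y (k + 1) - G (y (k + 1))) - (L • y k - G (y k))) := by module
  have inner_eq (u v : E) : α ^ 2 * inner ℝ u v = inner ℝ (α • u) (α • v) := by
    rw [real_inner_smul_left, real_inner_smul_right]
    ring
  have form := H.dissipationForm_eq_sub (x (k + 3) - a) (x (k + 2) - a) (x (k + 1) - a) (x k - a)
  rw [mul_add, inner_eq, output, smul_neg, hy, hx.smul_gradient_sub hR,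
    hx.smul_output_sub hR, inner_neg_neg] at supply
  simp only [dissipationForm, sub_sub_sub_cancel_right] at form
  have : 0 ≤ ρ * c / 2 * ‖(x (k + 3) - x (k + 2)) + (2 * h) • (x (k + 2) - x (k + 1))
    + (x (k + 1) - x k)‖ ^ 2 := by positivity
  simp only [momentumEnergy]
  linarith

theorem tendsto_of_tendsto_sub (hx : IsMomentumSequence α β η G x) (hα : α ≠ 0) (hm : 0 < m)
    (hG : ∀ y, m * ‖y - a‖ ≤ ‖G y‖)
    (hsub : Tendsto (fun k => x (k + 1) - x k) atTop (𝓝 0)) : Tendsto x atTop (𝓝 a) := by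
  have hsub' := hsub.comp (tendsto_add_atTop_nat 1)
  have hgrad : Tendsto (fun k => ‖G (extrapolation η x k)‖) atTop (𝓝 0) := by
    have hlim := ((hsub.const_smul β).sub hsub').const_smul α⁻¹
    simp only [smul_zero, sub_zero] at hlim
    refine tendsto_zero_iff_norm_tendsto_zero.1 (hlim.congr fun k => ?_)
    rw [inv_smul_eq_iff₀ hα, Function.comp, hx k]
    abel
  have hextra : Tendsto (fun k => extrapolation η x k - a) atTop (𝓝 0) := by
    have hlim := hgrad.const_mul m⁻¹
    rw [mul_zero] at hlim
    exact squeeze_zero_norm (fun k => (le_inv_mul_iff₀ hm).2 (hG _)) hlim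
  have hlim := (hextra.sub (hsub.const_smul η)).add_const a
  rw [smul_zero, sub_zero, zero_add] at hlim
  refine (tendsto_add_atTop_iff_nat 1).1 (hlim.congr fun k => ?_)
  unfold extrapolation
  abel

theorem tendsto_of_hasTangentBounds (hx : IsMomentumSequence α β η G x)
    (hf : HasTangentBounds m L f G) (hm : 0 < m) (hmL : m < L) (ha : G a = 0) (hα : α ≠ 0)
    (hR : HasEndpointRoots m L α β η ρ c) (hρ₀ : 0 < ρ) (hρ₁ : ρ < 1) (hc : 0 < c)
    (hD : c2mDisc ρ c < 0) : Tendsto x atTop (𝓝 a) := by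
  obtain ⟨h, δ, hδ, H⟩ := exists_isDissipationPair hρ₀ hc hD
  have hρc : 0 ≤ ρ * c := by positivity
  have hg := hf.sub_quadratic m a
  rw [sub_self] at hg
  set Φ := zamesFalbPotential (L - m) (fun y => f y - m / 2 * ‖y - a‖ ^ 2)
    (fun y => G y - m • (y - a))
  have energy_ge (k : ℕ) : α ^ 2 * Φ a ≤ momentumEnergy Φ α η ρ c h δ a x k :=
    le_add_of_le_of_nonneg (mul_le_mul_of_nonneg_left
      (hg.zamesFalbPotential_le (sub_pos.2 hmL) (by simp [ha]) _) (sq_nonneg α))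
      (H.storageForm_nonneg hρ₀ hρ₁ hc.le hδ.le _ _ _)
  have step_sq : Tendsto (fun k => δ / 2 * ‖x (k + 2) - x (k + 1)‖ ^ 2) atTop (𝓝 0) :=
    tendsto_zero_of_le_sub_succ (fun k => by positivity) energy_ge
      (hx.le_momentumEnergy_sub_succ hf hmL hR H hρc a)
  have step : Tendsto (fun k => x (k + 2) - x (k + 1)) atTop (𝓝 0) := by
    have hlim := (step_sq.const_mul (2 / δ)).sqrt
    simp only [← mul_assoc, div_mul_div_cancel₀ hδ.ne', div_self (two_ne_zero' ℝ), one_mul,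
      mul_zero, Real.sqrt_sq (norm_nonneg _), Real.sqrt_zero] at hlim
    exact tendsto_zero_iff_norm_tendsto_zero.2 hlim
  exact hx.tendsto_of_tendsto_sub hα hm (fun y => by simpa [ha] using hf.mul_norm_le_norm y a)
    ((tendsto_add_atTop_iff_nat 1).1 step)

end IsMomentumSequence

end GlobalConvergence

section LocalRate

theorem isBigO_pow_of_norm_add_le {X : Type*} [NormedAddCommGroup X] {u : ℕ → X} {r : ℝ} {N : ℕ}
    (hr : 0 < r) (hN : 0 < N) (h : ∀ᶠ k in atTop, ‖u (k + N)‖ ≤ r ^ N * ‖u k‖) :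
    u =O[atTop] fun k => r ^ k := by
  obtain ⟨K, hK⟩ := eventually_atTop.1 h
  obtain ⟨M, hM⟩ := ((Set.finite_Iio (K + N)).image fun k => ‖u k‖ / r ^ k).bddAbove
  suffices bound : ∀ k, ‖u k‖ / r ^ k ≤ M from
    Asymptotics.IsBigO.of_bound M <| Eventually.of_forall fun k => by
      rw [Real.norm_of_nonneg (by positivity), ← div_le_iff₀ (by positivity)]
      exact bound k
  intro k
  induction k using Nat.strong_induction_on with
  | _ k ih =>
    rcases lt_or_ge k (K + N) with hk | hk
    · exact hM ⟨k, hk, rfl⟩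
    obtain ⟨j, rfl⟩ := Nat.exists_eq_add_of_le' (le_of_add_le_right hk)
    refine le_trans ?_ (ih j (Nat.lt_add_of_pos_right hN))
    rw [div_le_div_iff₀ (by positivity) (by positivity), pow_add]
    calc ‖u (j + N)‖ * r ^ j ≤ r ^ N * ‖u j‖ * r ^ j := by
          gcongr
          exact hK j (by omega)
      _ = ‖u j‖ * (r ^ j * r ^ N) := by ring

theorem exists_mul_pow_lt_pow {C σ τ : ℝ} (hσ : 0 ≤ σ) (hστ : σ < τ) :
    ∃ N, 0 < N ∧ C * σ ^ N < τ ^ N := by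
  have hτ : 0 < τ := hσ.trans_lt hστ
  have hlim := (tendsto_pow_atTop_nhds_zero_of_lt_one (div_nonneg hσ hτ.le)
    ((div_lt_one hτ).2 hστ)).const_mul C
  rw [mul_zero] at hlim
  obtain ⟨N, hlt, hN⟩ := ((hlim.eventually_lt_const one_pos).and (eventually_gt_atTop 0)).exists
  rw [div_pow, ← mul_div_assoc, div_lt_one (by positivity)] at hlt
  exact ⟨N, hN, hlt⟩

theorem eventually_norm_sub_le_of_hasFDerivAt {X Y : Type*} [NormedAddCommGroup X]
    [NormedSpace ℝ X] [NormedAddCommGroup Y] [NormedSpace ℝ Y] {F : X → Y} {T : X →L[ℝ] Y} {a : X}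
    {r : ℝ} (hF : HasFDerivAt F T a) (hT : ‖T‖ < r) :
    ∀ᶠ z in 𝓝 a, ‖F z - F a‖ ≤ r * ‖z - a‖ := by
  filter_upwards [hF.isLittleO.def (sub_pos.2 hT)] with z hz
  calc ‖F z - F a‖ = ‖(F z - F a - T (z - a)) + T (z - a)‖ := by rw [sub_add_cancel]
    _ ≤ (r - ‖T‖) * ‖z - a‖ + ‖T‖ * ‖z - a‖ := norm_add_le_of_le hz (T.le_opNorm _)
    _ = r * ‖z - a‖ := by ring

/- A power of the linear part is a contraction, although the linear part itself need not be one. -/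
theorem isBigO_pow_of_hasFDerivAt {X : Type*} [NormedAddCommGroup X] [NormedSpace ℝ X] {F : X → X}
    {T : X →L[ℝ] X} {a : X} {z : ℕ → X} {C σ τ : ℝ} (hF : HasFDerivAt F T a) (ha : F a = a)
    (hz : ∀ k, z (k + 1) = F (z k)) (hlim : Tendsto z atTop (𝓝 a)) (hσ : 0 ≤ σ) (hστ : σ < τ)
    (hT : ∀ n, ‖T ^ n‖ ≤ C * σ ^ n) : (fun k => z k - a) =O[atTop] fun k => τ ^ k := by
  obtain ⟨N, hN, hlt⟩ := exists_mul_pow_lt_pow (C := C) hσ hστ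
  have hiter (k : ℕ) : z (k + N) = F^[N] (z k) := by
    clear hN hlt
    induction N with
    | zero => rfl
    | succ N ih => rw [← add_assoc, hz, ih, Function.iterate_succ_apply']
  have hcontr := hlim.eventually <|
    eventually_norm_sub_le_of_hasFDerivAt (hF.iterate ha N) ((hT N).trans_lt hlt)
  refine isBigO_pow_of_norm_add_le (hσ.trans_lt hστ) hN (hcontr.mono fun k hk => ?_)
  rwa [Function.iterate_fixed ha, ← hiter] at hk

theorem exists_norm_pow_le_of_quadratic {X : Type*} [NormedAddCommGroup X] [NormedSpace ℝ X]
    {T : X →L[ℝ] X} {V : X → ℝ} {μ K σ : ℝ} (hμ : 0 < μ) (hσ : 0 ≤ σ)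
    (lower : ∀ z, μ * ‖z‖ ^ 2 ≤ V z) (upper : ∀ z, V z ≤ K * ‖z‖ ^ 2)
    (step : ∀ z, V (T z) ≤ σ ^ 2 * V z) : ∃ C, ∀ n, ‖T ^ n‖ ≤ C * σ ^ n := by
  have iterate (n : ℕ) (z : X) : V ((T ^ n) z) ≤ (σ ^ n) ^ 2 * V z := by
    induction n with
    | zero => simp
    | succ n ih =>
      rw [pow_succ', mul_apply_eq_comp]
      calc V (T ((T ^ n) z)) ≤ σ ^ 2 * V ((T ^ n) z) := step _
        _ ≤ σ ^ 2 * ((σ ^ n) ^ 2 * V z) := by gcongr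
        _ = (σ ^ (n + 1)) ^ 2 * V z := by ring
  refine ⟨√(K / μ), fun n => ContinuousLinearMap.opNorm_le_bound _ (by positivity) fun z => ?_⟩
  have hsq : ‖(T ^ n) z‖ ^ 2 ≤ K / μ * (σ ^ n * ‖z‖) ^ 2 := by
    rw [div_mul_eq_mul_div, le_div_iff₀' hμ]
    calc μ * ‖(T ^ n) z‖ ^ 2 ≤ (σ ^ n) ^ 2 * V z := (lower _).trans (iterate n z)
      _ ≤ (σ ^ n) ^ 2 * (K * ‖z‖ ^ 2) := by gcongr; exact upper z
      _ = K * (σ ^ n * ‖z‖) ^ 2 := by ring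
  calc ‖(T ^ n) z‖ ≤ √(K / μ * (σ ^ n * ‖z‖) ^ 2) := Real.le_sqrt_of_sq_le hsq
    _ = √(K / μ) * σ ^ n * ‖z‖ := by
      rw [Real.sqrt_mul' _ (sq_nonneg _), Real.sqrt_sq (by positivity), mul_assoc]

variable {E : Type*} [NormedAddCommGroup E] [InnerProductSpace ℝ E]

/-- The linear part `(u, v) ↦ (Θ u - D v, u)` of a two-step iteration on pairs of successive
errors, with the newer error first. -/
def companion (Θ D : E →L[ℝ] E) : E × E →L[ℝ] E × E :=
  (Θ.comp (.fst ℝ E E) - D.comp (.snd ℝ E E)).prod (.fst ℝ E E)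

@[simp]
theorem companion_apply (Θ D : E →L[ℝ] E) (z : E × E) :
    companion Θ D z = (Θ z.1 - D z.2, z.1) := rfl

/-- A quadratic Lyapunov function of `companion Θ D` for the rate `σ`. For scalars `Θ`, `D` its
positivity is the Jury criterion for both roots of `z² - Θ z + D` to have modulus below `σ`. -/
noncomputable def companionEnergy (Θ D : E →L[ℝ] E) (σ : ℝ) (z : E × E) : ℝ :=
  inner ℝ (σ ^ 2 • z.1 + D z.1) z.1 + σ ^ 2 * inner ℝ (σ ^ 2 • z.2 + D z.2) z.2
    - 2 * σ ^ 2 * inner ℝ (Θ z.1) z.2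

section

variable {Θ D : E →L[ℝ] E} {σ μ : ℝ}

theorem companionEnergy_companion (hΘ : (Θ : E →ₗ[ℝ] E).IsSymmetric)
    (hD : (D : E →ₗ[ℝ] E).IsSymmetric) (σ : ℝ) (z : E × E) :
    let w := Θ z.1 - D z.2 - σ ^ 2 • z.2
    companionEnergy Θ D σ (companion Θ D z) = σ ^ 2 * companionEnergy Θ D σ z
      - inner ℝ (σ ^ 2 • w - D w) w := by
  obtain ⟨u, v⟩ := z
  obtain ⟨p, hp⟩ : ∃ p, Θ u = p + D v := ⟨Θ u - D v, by abel⟩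
  have hΘp : inner ℝ (Θ p) u = inner ℝ p (p + D v) := by rw [← hp]; exact hΘ p u
  have hDp : inner ℝ (D p) v = inner ℝ p (D v) := hD p v
  simp only [companionEnergy, companion_apply, hp, hΘp, add_sub_cancel_right, map_sub, map_smul,
    inner_add_left, inner_add_right, inner_sub_left, inner_sub_right, real_inner_smul_left,
    real_inner_smul_right, hDp, real_inner_comm p]
  ring

theorem two_mul_companionEnergy (hΘ : (Θ : E →ₗ[ℝ] E).IsSymmetric) (z : E × E) :
    let s := z.1 + σ • z.2
    let t := z.1 - σ • z.2
    2 * companionEnergy Θ D σ z = inner ℝ (σ ^ 2 • s + D s - σ • Θ s) s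
      + inner ℝ (σ ^ 2 • t + D t + σ • Θ t) t := by
  obtain ⟨u, v⟩ := z
  have hΘv : inner ℝ (Θ v) u = inner ℝ (Θ u) v := (hΘ v u).trans (real_inner_comm _ _)
  simp only [companionEnergy, map_add, map_sub, map_smul, inner_add_left, inner_add_right,
    inner_sub_left, inner_sub_right, real_inner_smul_left, real_inner_smul_right, hΘv]
  ring

theorem le_companionEnergy (hΘ : (Θ : E →ₗ[ℝ] E).IsSymmetric) (hμ : 0 ≤ μ)
    (hsub : ∀ u, μ * ‖u‖ ^ 2 ≤ inner ℝ (σ ^ 2 • u + D u - σ • Θ u) u)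
    (hadd : ∀ u, μ * ‖u‖ ^ 2 ≤ inner ℝ (σ ^ 2 • u + D u + σ • Θ u) u) (z : E × E) :
    μ * min 1 (σ ^ 2) * ‖z‖ ^ 2 ≤ companionEnergy Θ D σ z := by
  have hsum : μ * (‖z.1‖ ^ 2 + σ ^ 2 * ‖z.2‖ ^ 2) ≤ companionEnergy Θ D σ z := by
    have hpar := parallelogram_law_with_norm ℝ z.1 (σ • z.2)
    rw [norm_smul, mul_pow, Real.norm_eq_abs, sq_abs] at hpar
    linear_combination (hsub (z.1 + σ • z.2) + hadd (z.1 - σ • z.2)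
      - two_mul_companionEnergy (D := D) (σ := σ) hΘ z - μ * hpar) / 2
  refine le_trans ?_ hsum
  rw [mul_assoc]
  gcongr
  rcases max_choice ‖z.1‖ ‖z.2‖ with h | h <;> rw [Prod.norm_def, h]
  · exact le_add_of_le_of_nonneg (mul_le_of_le_one_left (by positivity) (min_le_left _ _))
      (by positivity)
  · exact le_add_of_nonneg_of_le (by positivity) (by gcongr; exact min_le_right _ _)

theorem companionEnergy_le (Θ D : E →L[ℝ] E) (σ : ℝ) (z : E × E) :
    companionEnergy Θ D σ z
      ≤ ((σ ^ 2 + ‖D‖) * (1 + σ ^ 2) + 2 * σ ^ 2 * ‖Θ‖) * ‖z‖ ^ 2 := by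
  have hS {u : E} (hu : ‖u‖ ≤ ‖z‖) : inner ℝ (σ ^ 2 • u + D u) u ≤ (σ ^ 2 + ‖D‖) * ‖z‖ ^ 2 := by
    rw [inner_add_left, real_inner_smul_left, real_inner_self_eq_norm_sq, add_mul]
    gcongr
    calc inner ℝ (D u) u ≤ ‖D u‖ * ‖u‖ := real_inner_le_norm _ _
      _ ≤ ‖D‖ * ‖z‖ * ‖z‖ := by gcongr; exact D.le_opNorm_of_le hu
      _ = ‖D‖ * ‖z‖ ^ 2 := by ring
  have hcross : -inner ℝ (Θ z.1) z.2 ≤ ‖Θ‖ * ‖z‖ ^ 2 :=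
    calc -inner ℝ (Θ z.1) z.2 ≤ ‖Θ z.1‖ * ‖z.2‖ :=
          (neg_le_abs _).trans (abs_real_inner_le_norm _ _)
      _ ≤ ‖Θ‖ * ‖z‖ * ‖z‖ := by
          gcongr
          exacts [Θ.le_opNorm_of_le (norm_fst_le z), norm_snd_le z]
      _ = ‖Θ‖ * ‖z‖ ^ 2 := by ring
  have h₁ := hS (norm_fst_le z)
  have h₂ := mul_le_mul_of_nonneg_left (hS (norm_snd_le z)) (sq_nonneg σ)
  have h₃ := mul_le_mul_of_nonneg_left hcross (sq_nonneg σ)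
  unfold companionEnergy
  linarith

theorem exists_norm_companion_pow_le (hΘ : (Θ : E →ₗ[ℝ] E).IsSymmetric)
    (hD : (D : E →ₗ[ℝ] E).IsSymmetric) (hσ : 0 < σ) (hμ : 0 < μ)
    (hdet : ∀ u, 0 ≤ inner ℝ (σ ^ 2 • u - D u) u)
    (hsub : ∀ u, μ * ‖u‖ ^ 2 ≤ inner ℝ (σ ^ 2 • u + D u - σ • Θ u) u)
    (hadd : ∀ u, μ * ‖u‖ ^ 2 ≤ inner ℝ (σ ^ 2 • u + D u + σ • Θ u) u) :
    ∃ C, ∀ n, ‖companion Θ D ^ n‖ ≤ C * σ ^ n :=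
  exists_norm_pow_le_of_quadratic (by positivity) hσ.le (le_companionEnergy hΘ hμ.le hsub hadd)
    (companionEnergy_le Θ D σ) fun z =>
      (companionEnergy_companion hΘ hD σ z).trans_le (sub_le_self _ (hdet _))

end

/-- `A` is a self-adjoint operator with numerical range in `[m, L]`: the derivative of the gradient
of a function whose curvature lies between `m` and `L`. -/
structure IsCurvatureOperator (m L : ℝ) (A : E →L[ℝ] E) : Prop where
  isSymmetric : (A : E →ₗ[ℝ] E).IsSymmetric
  lower : ∀ u, m * ‖u‖ ^ 2 ≤ inner ℝ (A u) u
  upper : ∀ u, inner ℝ (A u) u ≤ L * ‖u‖ ^ 2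

theorem isSymmetric_of_hasFDerivAt_gradient {f : E → ℝ} {G : E → E} {A : E →L[ℝ] E} {a : E}
    (hf : ∀ y, HasFDerivAt f (innerSL ℝ (G y)) y) (hA : HasFDerivAt G A a) :
    (A : E →ₗ[ℝ] E).IsSymmetric := by
  let B : E →L[ℝ] E →L[ℝ] ℝ := innerSL ℝ
  intro u v
  exact (second_derivative_symmetric hf (B.hasFDerivAt.comp a hA) u v).trans (real_inner_comm _ _)

theorem HasTangentBounds.isCurvatureOperator {m L : ℝ} {f : E → ℝ} {G : E → E} {A : E →L[ℝ] E}
    {a : E} (hf : HasTangentBounds m L f G) (hG : ∀ y, HasFDerivAt f (innerSL ℝ (G y)) y)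
    (hA : HasFDerivAt G A a) : IsCurvatureOperator m L A := by
  have hslope (u : E) : Tendsto (fun t : ℝ => inner ℝ (t⁻¹ • (G (a + t • u) - G a)) u) (𝓝[≠] 0)
      (𝓝 (inner ℝ (A u) u)) :=
    (hA.hasLineDerivAt u).tendsto_slope_zero.inner tendsto_const_nhds
  have hscale {t : ℝ} (ht : t ≠ 0) (u : E) : inner ℝ (t⁻¹ • (G (a + t • u) - G a)) u
      = (t ^ 2)⁻¹ * inner ℝ (G (a + t • u) - G a) (a + t • u - a) := by
    rw [add_sub_cancel_left, real_inner_smul_left, real_inner_smul_right]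
    field_simp
  have hnorm (t : ℝ) (u : E) : ‖a + t • u - a‖ ^ 2 = t ^ 2 * ‖u‖ ^ 2 := by
    rw [add_sub_cancel_left, norm_smul, mul_pow, Real.norm_eq_abs, sq_abs]
  refine ⟨isSymmetric_of_hasFDerivAt_gradient hG hA, fun u => ge_of_tendsto (hslope u) ?_,
    fun u => le_of_tendsto (hslope u) ?_⟩
  all_goals
    filter_upwards [self_mem_nhdsWithin] with t (ht : t ≠ 0)
    rw [hscale ht]
  · rw [le_inv_mul_iff₀ (by positivity), mul_left_comm, ← hnorm]
    exact hf.mul_norm_sq_le_inner _ _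
  · rw [inv_mul_le_iff₀ (by positivity), mul_left_comm, ← hnorm]
    exact hf.inner_le_mul_norm_sq _ _

namespace IsCurvatureOperator

variable {m L : ℝ} {A : E →L[ℝ] E}

theorem isSymmetric_affine (hA : IsCurvatureOperator m L A) (p q : ℝ) :
    ((p • .id ℝ E - q • A : E →L[ℝ] E) : E →ₗ[ℝ] E).IsSymmetric := by
  intro u v
  have := hA.isSymmetric u v
  simp_all [inner_sub_left, inner_sub_right, real_inner_smul_left, real_inner_smul_right]

theorem mul_norm_sq_le_inner_affine (hA : IsCurvatureOperator m L A) {p q μ : ℝ}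
    (hm : μ ≤ p + q * m) (hL : μ ≤ p + q * L) (u : E) :
    μ * ‖u‖ ^ 2 ≤ inner ℝ (p • u + q • A u) u := by
  rw [inner_add_left, real_inner_smul_left, real_inner_smul_left, real_inner_self_eq_norm_sq]
  rcases le_total 0 q with hq | hq
  · nlinarith [mul_le_mul_of_nonneg_left (hA.lower u) hq, sq_nonneg ‖u‖]
  · nlinarith [mul_le_mul_of_nonpos_left (hA.upper u) hq, sq_nonneg ‖u‖]

end IsCurvatureOperator

/-- The momentum iteration as a map of the pair `(x (k + 1), x k)`. -/
def momentumMap (α β η : ℝ) (G : E → E) (z : E × E) : E × E :=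
  (z.1 + β • (z.1 - z.2) - α • G (z.1 + η • (z.1 - z.2)), z.1)

/-- The derivative of `momentumMap α β η G` at a critical point where `G` has derivative `A`. -/
def momentumDeriv (α β η : ℝ) (A : E →L[ℝ] E) : E × E →L[ℝ] E × E :=
  companion ((1 + β) • .id ℝ E - (α * (1 + η)) • A) (β • .id ℝ E - (α * η) • A)

theorem hasFDerivAt_momentumMap {α β η : ℝ} {G : E → E} {A : E →L[ℝ] E} {a : E}
    (hA : HasFDerivAt G A a) :
    HasFDerivAt (momentumMap α β η G) (momentumDeriv α β η A) (a, a) := by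
  let P (γ : ℝ) : E × E →L[ℝ] E := .fst ℝ E E + γ • (.fst ℝ E E - .snd ℝ E E)
  have hP : P η (a, a) = a := by simp [P]
  rw [← hP] at hA
  refine (((P β).hasFDerivAt.sub ((hA.comp _ (P η).hasFDerivAt).const_smul α)).prodMk
    hasFDerivAt_fst).congr_fderiv (ContinuousLinearMap.ext fun z => Prod.ext ?_ rfl)
  simp only [P, momentumDeriv, ContinuousLinearMap.comp_apply, ContinuousLinearMap.prod_apply,
    ContinuousLinearMap.coe_fst', ContinuousLinearMap.coe_snd', ContinuousLinearMap.id_apply,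
    companion_apply, sub_apply, add_apply, smul_apply, map_add, map_sub, map_smul]
  module

theorem IsCurvatureOperator.exists_norm_momentumDeriv_pow_le {m L α β η ρ c σ : ℝ} {A : E →L[ℝ] E}
    (hA : IsCurvatureOperator m L A) (hR : HasEndpointRoots m L α β η ρ c) (hc : 0 ≤ c)
    (hcρ : c ≤ ρ) (hσ : ρ < σ) : ∃ C, ∀ n, ‖momentumDeriv α β η A ^ n‖ ≤ C * σ ^ n := by
  have hρ : 0 ≤ ρ := hc.trans hcρ
  have hσ₀ : 0 < σ := hρ.trans_lt hσ
  have gap_right : (σ - ρ) ^ 2 ≤ (σ - ρ) * (σ - c) := by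
    rw [sq]
    exact mul_le_mul_of_nonneg_left (by linarith) (sub_nonneg.2 hσ.le)
  have gap_left : (σ - ρ) ^ 2 ≤ (σ + ρ) * (σ + c) :=
    gap_right.trans (mul_le_mul (by linarith) (by linarith) (by linarith) (by linarith))
  have det_left : 0 ≤ σ ^ 2 - ρ ^ 2 := sub_nonneg.2 (pow_le_pow_left₀ hρ hσ.le 2)
  have det_right : 0 ≤ σ ^ 2 - ρ * c := by
    linarith [mul_le_mul_of_nonneg_left hcρ hρ]
  refine exists_norm_companion_pow_le (μ := (σ - ρ) ^ 2) (hA.isSymmetric_affine _ _)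
    (hA.isSymmetric_affine _ _) hσ₀ (pow_pos (sub_pos.2 hσ) 2) (fun u => ?_) (fun u => ?_)
    fun u => ?_
  · have h := hA.mul_norm_sq_le_inner_affine (p := σ ^ 2 - β) (q := α * η) (μ := 0)
      (by linear_combination det_left + hR.det_left)
      (by linear_combination det_right + hR.det_right) u
    rw [zero_mul] at h
    convert h using 2
    simp only [sub_apply, smul_apply, ContinuousLinearMap.id_apply]
    module
  · convert hA.mul_norm_sq_le_inner_affine (μ := (σ - ρ) ^ 2)
      (p := σ ^ 2 + β - σ * (1 + β)) (q := σ * (α * (1 + η)) - α * η)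
      (by linear_combination σ * hR.trace_left - hR.det_left)
      (by linear_combination gap_left + σ * hR.trace_right - hR.det_right) u using 2
    simp only [sub_apply, smul_apply, ContinuousLinearMap.id_apply]
    module
  · have := mul_nonneg hσ₀.le hρ
    convert hA.mul_norm_sq_le_inner_affine (μ := (σ - ρ) ^ 2)
      (p := σ ^ 2 + β + σ * (1 + β)) (q := -(σ * (α * (1 + η)) + α * η))
      (by linear_combination 4 * this - σ * hR.trace_left - hR.det_left)
      (by linear_combination gap_right - σ * hR.trace_right - hR.det_right) u using 2
    simp only [sub_apply, smul_apply, ContinuousLinearMap.id_apply]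
    module

theorem IsMomentumSequence.isBigO_pow {m L α β η ρ c σ : ℝ} {G : E → E} {A : E →L[ℝ] E}
    {x : ℕ → E} {a : E} (hx : IsMomentumSequence α β η G x) (hlim : Tendsto x atTop (𝓝 a))
    (ha : G a = 0) (hGA : HasFDerivAt G A a) (hA : IsCurvatureOperator m L A)
    (hR : HasEndpointRoots m L α β η ρ c) (hc : 0 ≤ c) (hcρ : c ≤ ρ) (hσ : ρ < σ) :
    (fun k => x k - a) =O[atTop] fun k => σ ^ k := by
  obtain ⟨τ, hρτ, hτσ⟩ := exists_between hσ
  obtain ⟨C, hC⟩ := hA.exists_norm_momentumDeriv_pow_le hR hc hcρ hρτ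
  have hpair : (fun k => (x (k + 1), x k) - (a, a)) =O[atTop] fun k => σ ^ k :=
    isBigO_pow_of_hasFDerivAt (hasFDerivAt_momentumMap hGA) (by simp [momentumMap, ha])
      (fun k => Prod.ext (hx k) rfl) (((tendsto_add_atTop_iff_nat 1).2 hlim).prodMk_nhds hlim)
      (hc.trans (hcρ.trans hρτ.le)) hτσ hC
  exact Asymptotics.isBigO_snd_prod.trans hpair

end LocalRate

section RootConvergence

theorem rootConvergenceFactor_le_of_isBigO {E : Type*} [NormedAddCommGroup E] {x : ℕ → E} {a : E}
    {σ : ℝ} (hσ : 0 ≤ σ) (h : (fun k => x k - a) =O[atTop] fun k => σ ^ k) :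
    rootConvergenceFactor x a ≤ ENNReal.ofReal σ := by
  obtain ⟨C, hC, hbound⟩ := h.exists_pos
  have hlim : Tendsto (fun k : ℕ => ENNReal.ofReal (C ^ (1 / (k : ℝ)) * σ)) atTop
      (𝓝 (ENNReal.ofReal σ)) := by
    have hroot : Tendsto (fun k : ℕ => C ^ (1 / (k : ℝ))) atTop (𝓝 (C ^ (0 : ℝ))) :=
      tendsto_const_nhds.rpow tendsto_one_div_atTop_nhds_zero_nat (Or.inl hC.ne')
    rw [Real.rpow_zero] at hroot
    simpa only [one_mul] using ENNReal.tendsto_ofReal (hroot.mul_const σ)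
  refine (limsup_le_limsup ?_).trans hlim.limsup_eq.le
  filter_upwards [hbound.bound, eventually_ge_atTop 1] with k hk hk₁
  rw [Real.norm_of_nonneg (by positivity)] at hk
  rw [← ofReal_norm, ENNReal.ofReal_rpow_of_nonneg (norm_nonneg _) (by positivity)]
  refine ENNReal.ofReal_le_ofReal ?_
  calc ‖x k - a‖ ^ (1 / (k : ℝ)) ≤ (C * σ ^ k) ^ (1 / (k : ℝ)) := by gcongr
    _ = C ^ (1 / (k : ℝ)) * σ := by
      rw [Real.mul_rpow (by positivity) (by positivity), one_div,
        Real.pow_rpow_inv_natCast hσ (by omega)]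

theorem rootConvergenceFactor_le_of_forall_lt {E : Type*} [NormedAddCommGroup E] {x : ℕ → E} {a : E}
    {ρ : ℝ} (hρ : 0 ≤ ρ) (h : ∀ σ, ρ < σ → (fun k => x k - a) =O[atTop] fun k => σ ^ k) :
    rootConvergenceFactor x a ≤ ENNReal.ofReal ρ := by
  have hlim : Tendsto ENNReal.ofReal (𝓝[>] ρ) (𝓝 (ENNReal.ofReal ρ)) :=
    (ENNReal.continuous_ofReal.tendsto ρ).mono_left nhdsWithin_le_nhds
  refine ge_of_tendsto hlim ?_
  filter_upwards [self_mem_nhdsWithin] with σ (hσ : ρ < σ)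
  exact rootConvergenceFactor_le_of_isBigO (hρ.trans hσ.le) (h σ hσ)

end RootConvergence

theorem hasFDerivAt_innerSL_gradient {E : Type*} [NormedAddCommGroup E] [InnerProductSpace ℝ E]
    [CompleteSpace E] {f : E → ℝ} {x : E} (hf : DifferentiableAt ℝ f x) :
    HasFDerivAt f (innerSL ℝ (∇ f x)) x :=
  hf.hasGradientAt.hasFDerivAt

theorem differentiable_gradient_of_contDiff {E : Type*} [NormedAddCommGroup E]
    [InnerProductSpace ℝ E] [CompleteSpace E] {f : E → ℝ} (hf : ContDiff ℝ 2 f) :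
    Differentiable ℝ (∇ f) := by
  have hd : Differentiable ℝ (fderiv ℝ f) :=
    (hf.fderiv_right (m := 1) (by norm_num)).differentiable (by norm_num)
  exact (InnerProductSpace.toDual ℝ E).symm.toContinuousLinearEquiv.differentiable.comp hd

theorem worstCaseRootConvergenceFactor_le {d : ℕ} {α β η : ℝ}
    {F : Set (EuclideanSpace ℝ (Fin d) → ℝ)} {r : ℝ≥0∞}
    (h : ∀ f ∈ F, ∃ a, ∀ xinit x0, Tendsto (momentumIterates α β η f xinit x0) atTop (𝓝 a) ∧
      rootConvergenceFactor (momentumIterates α β η f xinit x0) a ≤ r) :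
    worstCaseRootConvergenceFactor α β η F ≤ r := by
  apply sSup_le
  rintro _ ⟨f, hf, xinit, x0, xstar, hx, rfl⟩
  obtain ⟨a, ha⟩ := h f hf
  obtain ⟨hlim, hrate⟩ := ha xinit x0
  rwa [tendsto_nhds_unique hx hlim]

theorem isMomentumSequence_momentumIterates {d : ℕ} (α β η : ℝ)
    (f : EuclideanSpace ℝ (Fin d) → ℝ) (xinit x0 : EuclideanSpace ℝ (Fin d)) :
    IsMomentumSequence α β η (∇ f) (momentumIterates α β η f xinit x0) :=
  fun _ => rfl

theorem theorem1_general {E : Type*} [NormedAddCommGroup E] [InnerProductSpace ℝ E]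
    [CompleteSpace E] {f : E → ℝ} {m L ρ : ℝ} (hm : 0 < m)
    (hρ : ρ ∈ Set.Ioo (0 : ℝ) 1) (hρκ : IsC2MParameter (L / m) ρ) (hf : Differentiable ℝ f)
    (hconv : StrongConvexOn Set.univ m f) (hlip : ∀ x y, ‖∇ f x - ∇ f y‖ ≤ L * ‖x - y‖) :
    ∃ xstar, (∀ y, y ≠ xstar → f xstar < f y) ∧
      ∀ x, IsMomentumSequence (c2mAlpha m ρ) (c2mBeta (L / m) ρ) (c2mEta (L / m) ρ) (∇ f) x →
        Tendsto x atTop (𝓝 xstar) ∧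
          (DifferentiableAt ℝ (∇ f) xstar →
            rootConvergenceFactor x xstar ≤ ENNReal.ofReal ρ) := by
  have ⟨hρ₀, hρ₁⟩ := hρ
  have hκ : 1 < L / m := one_lt_of_isC2MParameter hρ₀ hρκ
  have hmL : m < L := (one_lt_div hm).1 hκ
  obtain ⟨hc, hcρ, hD⟩ := c2mRoot_bounds hκ hρ hρκ
  have hR := hasEndpointRoots_c2m hm.ne' hκ.ne' (by linarith) (sub_ne_zero.2 hρ₁.ne')
  have hα : c2mAlpha m ρ ≠ 0 := (div_pos (pow_pos (sub_pos.2 hρ₁) 2) hm).ne'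
  have hT := hasTangentBounds_gradient hf hconv hlip
  obtain ⟨a, ha⟩ := exists_eq_zero_of_strongly_monotone hm (hm.trans hmL) hT.mul_norm_sq_le_inner
    hlip
  refine ⟨a, fun y hy => hT.lt_of_ne hm ha hy, fun x hx => ?_⟩
  have hlim := hx.tendsto_of_hasTangentBounds hT hm hmL ha hα hR hρ₀ hρ₁ hc hD
  refine ⟨hlim, fun hdiff => rootConvergenceFactor_le_of_forall_lt hρ₀.le fun σ hσ => ?_⟩
  have hA := hT.isCurvatureOperator (fun y => hasFDerivAt_innerSL_gradient (hf y)) hdiff.hasFDerivAt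
  exact hx.isBigO_pow hlim ha hdiff.hasFDerivAt hA hR hc.le hcρ hσ

theorem theorem1 (d : ℕ) (m L ρ : ℝ) (hm : 0 < m) (hmL : m ≤ L) (hρ : ρ ∈ Set.Ioo (0 : ℝ) 1)
    (hρκ : IsC2MParameter (L / m) ρ) :
    (∀ f : EuclideanSpace ℝ (Fin d) → ℝ, SmoothStronglyConvexC2 m L f →
      ∃ xstar, (∀ y, y ≠ xstar → f xstar < f y) ∧
        ∀ xinit x0 : EuclideanSpace ℝ (Fin d),
          Tendsto (momentumIterates (c2mAlpha m ρ) (c2mBeta (L / m) ρ) (c2mEta (L / m) ρ) f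
            xinit x0) atTop (𝓝 xstar)) ∧
    worstCaseRootConvergenceFactor (c2mAlpha m ρ) (c2mBeta (L / m) ρ) (c2mEta (L / m) ρ)
      {f : EuclideanSpace ℝ (Fin d) → ℝ | SmoothStronglyConvexC2 m L f} ≤ ENNReal.ofReal ρ := by
  have hgen (f : EuclideanSpace ℝ (Fin d) → ℝ) (hf : SmoothStronglyConvexC2 m L f) :=
    theorem1_general hm hρ hρκ (hf.contDiff.differentiable two_ne_zero) hf.strongConvex
      hf.lipschitz_gradient
  have hiter := isMomentumSequence_momentumIterates (d := d) (c2mAlpha m ρ) (c2mBeta (L / m) ρ)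
    (c2mEta (L / m) ρ)
  refine ⟨fun f hf => ?_, worstCaseRootConvergenceFactor_le fun f hf => ?_⟩
  · obtain ⟨a, hmin, ha⟩ := hgen f hf
    exact ⟨a, hmin, fun xinit x0 => (ha _ (hiter f xinit x0)).1⟩
  · obtain ⟨a, -, ha⟩ := hgen f hf
    exact ⟨a, fun xinit x0 => (ha _ (hiter f xinit x0)).imp_right fun h =>
      h (differentiable_gradient_of_contDiff hf.contDiff a)⟩
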